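/- **Corollary (LSTIC based on the $6\times 6$ perfect STBC).** Let $\omega=e^{2\pi i/3}$, $\zeta_{28}=e^{2\pi i/28}$, $\theta=\zeta_{28}+\zeta_{28}^{-1}=2\cos(\pi/14)$, $\mathbb K=\mathbb Q(\omega)$, $\mathbb L=\mathbb Q(\omega,\theta)$, $\gamma=-\omega$, and let $\sigma$ be the automorphism of $\mathbb L/\mathbb K$ with $\sigma(\theta)=\zeta_{28}^5+\zeta_{28}^{-5}$. For $x=(x_0,\dots,x_5)\in\mathcal O_{\mathbb L}^6$ let $\mathbf X(x)\in\mathbb C^{6\times 6}$ be the matrix with entry $\sigma^i(x_{j-i})$ in position $(i,j)$ if $0\le i\le j\le 5$, and $\gamma\,\sigma^i(x_{j-i+6})$ if $0\le j<i\le 5$. Let $\mathfrak I$ be an ideal of $\mathcal O_{\mathbb L}$ with $7\mathcal O_{\mathbb L}=\mathfrak I^6\,\overline{\mathfrak I}^{\,6}$, where the bar is complex conjugation. Let $K\in\mathbb N$ and let $\mathfrak q_1,\dots,\mathfrak q_K$ be nonzero ideals of $\mathcal O_{\mathbb L}$ that are pairwise relatively prime and relatively prime to $\mathfrak I$; put $\mathfrak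 q=\mathfrak q_1\cdots\mathfrak q_K$, and let $$\mathcal M:\ \mathcal O_{\mathbb L}/\mathfrak q_1\times\cdots\times\mathcal O_{\mathbb L}/\mathfrak q_K\ \to\ \mathfrak I/\mathfrak I\mathfrak q$$ be an isomorphism of $\mathcal O_{\mathbb L}$-modules. A message $w_k=(w_{k,0},\dots,w_{k,5})$ is an element of $(\mathcal O_{\mathbb L}/\mathfrak q_k)^6$. The codewords of the messages $(w_1,\dots,w_K)$ are the matrices $\mathbf X(x)$ with $x_\ell\in\mathfrak I$ in the coset $\mathcal M(w_{1,\ell},\dots,w_{K,\ell})$ for $\ell=0,\dots,5$. The code $\mathcal C$ is the set of the codewords of all messages. For $\mathcal S\subseteq\{1,\dots,K\}$ and known values $w_s=v_s$ $(s\in\mathcal S)$, $\mathcal C_{\mathcal S}$ is the set of the codewords of all messages with $w_s=v_s$ for $s\in\mathcal S$. Let $$\delta(\mathcal D)=\min_{\mathbf X\ne\mathbf X'\in\mathcal D}\det\big((\mathbf X-\mathbf X')(\mathbf X-\mathbf X')^\dagger\big)$$ for $\mathcal D=\mathcal C,\mathcal C_{\mathcal S}$. The rate of $w_k$ is $R_k=\frac{1}{2\cdot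 6^2}\log_2\big|(\mathcal O_{\mathbb L}/\mathfrak q_k)^6\big|$ bits per real symbol, $R_{\mathcal S}=\sum_{s\in\mathcal S}R_s$, and the side information gain is $$\Gamma(\mathcal C,\mathcal S)=\frac{10\log_{10}\big(\delta(\mathcal C_{\mathcal S})/\delta(\mathcal C)\big)}{6\,R_{\mathcal S}} .$$ Let $$\gamma_{\mathfrak I}=20\log_{10}\left(\frac{N(\mathfrak I)}{\min_{0\ne x\in\mathfrak I}N_{\mathbb L/\mathbb Q}(x)}\right).$$ Then $\delta(\mathcal C)>0$, and for every $\mathcal S\subseteq\{1,\dots,K\}$ with $R_{\mathcal S}>0$ (that is, with $\mathfrak q_s\ne\mathcal O_{\mathbb L}$ for some $s\in\mathcal S$) and all values $v_s$, $$\Gamma(\mathcal C,\mathcal S)\ \ge\ 20\log_{10}2+\gamma_{\mathfrak I}\ \ge\ 6+\gamma_{\mathfrak I}\quad\text{dB per bit per real symbol.}$$ The constant $\gamma_{\mathfrak I}$ depends only on $\mathfrak I$, and $\gamma_{\mathfrak I}<0$ if $\mathfrak I$ is not principal. -/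

import Mathlib

namespace SixBySix

open NumberField

noncomputable section

/-- The primitive cube root of unity `ω = exp (2πi/3)`. -/
def omega : ℂ := Complex.exp (2 * Real.pi * Complex.I / 3)

/-- The primitive 28th root of unity `ζ₂₈ = exp (2πi/28)`. -/
def zeta28 : ℂ := Complex.exp (2 * Real.pi * Complex.I / 28)

/-- The real number `θ = 2 cos (π/14)`, seen in `ℂ`. -/
def theta : ℂ := ((2 * Real.cos (Real.pi / 14) : ℝ) : ℂ)

/-- The primitive 84th root of unity; an auxiliary number for constructing `sigma`. -/
def zeta84 : ℂ := Complex.exp (2 * Real.pi * Complex.I / 84)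

theorem zeta84_primitive : IsPrimitiveRoot zeta84 84 := by
  have := Complex.isPrimitiveRoot_exp 84 (by norm_num)
  simpa [zeta84] using this

theorem zeta84_pow_three : zeta84 ^ 3 = zeta28 := by
  rw [zeta84, zeta28, ← Complex.exp_nat_mul]
  congr 1; push_cast; ring

theorem zeta84_pow_28 : zeta84 ^ 28 = omega := by
  rw [zeta84, omega, ← Complex.exp_nat_mul]
  congr 1; push_cast; ring

theorem theta_eq : theta = zeta28 + zeta28⁻¹ := by
  rw [theta, zeta28, ← Complex.exp_neg]
  push_cast
  rw [Complex.two_cos]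
  congr 2 <;> ring

theorem zeta28_ne_zero : zeta28 ≠ 0 := Complex.exp_ne_zero _

/-- The field `L = ℚ(ω, θ)`, a subfield of `ℂ`. -/
abbrev L : IntermediateField ℚ ℂ := IntermediateField.adjoin ℚ {omega, theta}

theorem omega_mem : omega ∈ L := IntermediateField.subset_adjoin ℚ _ (by simp)

theorem theta_mem : theta ∈ L := IntermediateField.subset_adjoin ℚ _ (by simp)

theorem omega_isIntegral : IsIntegral ℚ omega := by
  rw [← zeta84_pow_28]
  exact (zeta84_primitive.isIntegral (by norm_num)).tower_top.pow _

theorem theta_isIntegral : IsIntegral ℚ theta := by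
  have h : IsIntegral ℚ zeta28 := by
    rw [← zeta84_pow_three]
    exact (zeta84_primitive.isIntegral (by norm_num)).tower_top.pow _
  rw [theta_eq]
  exact h.add h.inv

instance : FiniteDimensional ℚ L := by
  apply IntermediateField.finiteDimensional_adjoin
  rintro x (rfl | rfl)
  · exact omega_isIntegral
  · exact theta_isIntegral

instance : NumberField L where

/-- An embedding of `L` in `ℂ` that maps `ω` and `θ` into `L` is an automorphism of `L`. -/
theorem exists_aut (f : L →ₐ[ℚ] ℂ) (h1 : f ⟨omega, omega_mem⟩ ∈ L)
    (h2 : f ⟨theta, theta_mem⟩ ∈ L) : ∃ s : L ≃ₐ[ℚ] L, ∀ x, (s x : ℂ) = f x := by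
  have key : ∀ x : L, f x ∈ L := by
    rintro ⟨x, hx⟩
    induction hx using IntermediateField.adjoin_induction with
    | mem y hy =>
      rcases hy with rfl | rfl
      · exact h1
      · exact h2
    | algebraMap y =>
      have h : f ⟨algebraMap ℚ ℂ y, L.algebraMap_mem y⟩ = algebraMap ℚ ℂ y := f.commutes y
      rw [h]
      exact L.algebraMap_mem y
    | add y z hy hz ihy ihz =>
      have h := map_add f ⟨y, hy⟩ ⟨z, hz⟩
      exact h ▸ add_mem ihy ihz
    | inv y hy ih =>
      have h := map_inv₀ f ⟨y, hy⟩
      exact h ▸ inv_mem ih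
    | mul y z hy hz ihy ihz =>
      have h := map_mul f ⟨y, hy⟩ ⟨z, hz⟩
      exact h ▸ mul_mem ihy ihz
  let g : L →ₐ[ℚ] L := f.codRestrict L.toSubalgebra key
  exact ⟨AlgEquiv.ofBijective g (Algebra.IsAlgebraic.algHom_bijective g), fun x => rfl⟩

theorem exists_sigma : ∃ s : L ≃ₐ[ℚ] L, (s ⟨omega, omega_mem⟩ : ℂ) = omega ∧
    (s ⟨theta, theta_mem⟩ : ℂ) = zeta28 ^ 5 + (zeta28 ^ 5)⁻¹ := by
  let E : IntermediateField ℚ ℂ := IntermediateField.adjoin ℚ {zeta84}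
  have hz : zeta84 ∈ E := IntermediateField.mem_adjoin_simple_self ℚ zeta84
  have hLE : L ≤ E := by
    apply IntermediateField.adjoin_le_iff.2
    rintro x (rfl | rfl)
    · rw [← zeta84_pow_28]
      exact pow_mem hz _
    · rw [theta_eq, ← zeta84_pow_three]
      exact add_mem (pow_mem hz _) (inv_mem (pow_mem hz _))
  have hint : IsIntegral ℚ zeta84 := (zeta84_primitive.isIntegral (by norm_num)).tower_top
  have hprim : IsPrimitiveRoot (zeta84 ^ 61) 84 :=
    zeta84_primitive.pow_of_coprime 61 (by norm_num)
  have hroot : Polynomial.aeval (zeta84 ^ 61) (minpoly ℚ zeta84) = 0 := by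
    rw [← Polynomial.cyclotomic_eq_minpoly_rat zeta84_primitive (by norm_num),
      Polynomial.cyclotomic_eq_minpoly_rat hprim (by norm_num)]
    exact minpoly.aeval _ _
  let t : E →ₐ[ℚ] ℂ := (IntermediateField.algHomAdjoinIntegralEquiv ℚ hint).symm
    ⟨zeta84 ^ 61, (Polynomial.mem_aroots).2 ⟨minpoly.ne_zero hint, hroot⟩⟩
  have ht : t ⟨zeta84, hz⟩ = zeta84 ^ 61 :=
    IntermediateField.algHomAdjoinIntegralEquiv_symm_apply_gen ℚ hint _
  let f : L →ₐ[ℚ] ℂ := t.comp (IntermediateField.inclusion hLE)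
  have hp : zeta84 ^ 84 = 1 := zeta84_primitive.pow_eq_one
  have h28 : zeta28 ^ 28 = 1 := by rw [← zeta84_pow_three, ← pow_mul]; exact hp
  have hw : f ⟨omega, omega_mem⟩ = omega := by
    have e : IntermediateField.inclusion hLE ⟨omega, omega_mem⟩ = (⟨zeta84, hz⟩ : E) ^ 28 :=
      Subtype.ext zeta84_pow_28.symm
    change t (IntermediateField.inclusion hLE ⟨omega, omega_mem⟩) = omega
    rw [e, map_pow, ht, ← zeta84_pow_28]
    calc (zeta84 ^ 61) ^ 28 = (zeta84 ^ 84) ^ 20 * zeta84 ^ 28 := by ring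
      _ = zeta84 ^ 28 := by rw [hp]; ring
  have hth : f ⟨theta, theta_mem⟩ = zeta28 ^ 5 + (zeta28 ^ 5)⁻¹ := by
    have e : IntermediateField.inclusion hLE ⟨theta, theta_mem⟩ =
        (⟨zeta84, hz⟩ : E) ^ 3 + ((⟨zeta84, hz⟩ : E) ^ 3)⁻¹ :=
      Subtype.ext (by
        change theta = zeta84 ^ 3 + (zeta84 ^ 3)⁻¹
        rw [theta_eq, zeta84_pow_three])
    change t (IntermediateField.inclusion hLE ⟨theta, theta_mem⟩) = _
    have e2 : (zeta84 ^ 61) ^ 3 = zeta28 ^ 5 := by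
      calc (zeta84 ^ 61) ^ 3 = (zeta84 ^ 3) ^ 61 := by ring
        _ = zeta28 ^ 61 := by rw [zeta84_pow_three]
        _ = (zeta28 ^ 28) ^ 2 * zeta28 ^ 5 := by ring
        _ = zeta28 ^ 5 := by rw [h28]; ring
    rw [e, map_add, map_inv₀, map_pow, ht, e2]
  have hmem : zeta28 ^ 5 + (zeta28 ^ 5)⁻¹ ∈ L := by
    have h : zeta28 ^ 5 + (zeta28 ^ 5)⁻¹ = theta ^ 5 - 5 * theta ^ 3 + 5 * theta := by
      rw [theta_eq]
      field_simp [zeta28_ne_zero]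
      ring
    rw [h]
    have h5 : (5 : ℂ) ∈ L := by exact_mod_cast natCast_mem L 5
    exact add_mem (sub_mem (pow_mem theta_mem _) (mul_mem h5 (pow_mem theta_mem _)))
      (mul_mem h5 theta_mem)
  obtain ⟨s, hs⟩ := exists_aut f (by rw [hw]; exact omega_mem) (by rw [hth]; exact hmem)
  exact ⟨s, by rw [hs, hw], by rw [hs, hth]⟩

/-- The automorphism `σ` of `L` that fixes `ω` and maps `θ = ζ₂₈ + ζ₂₈⁻¹` to `ζ₂₈⁵ + ζ₂₈⁻⁵`. -/
def sigma : L ≃ₐ[ℚ] L := exists_sigma.choose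

theorem sigma_omega : (sigma ⟨omega, omega_mem⟩ : ℂ) = omega := exists_sigma.choose_spec.1

theorem sigma_theta : (sigma ⟨theta, theta_mem⟩ : ℂ) = zeta28 ^ 5 + (zeta28 ^ 5)⁻¹ :=
  exists_sigma.choose_spec.2

theorem exists_conj : ∃ s : L ≃ₐ[ℚ] L, ∀ x, (s x : ℂ) = starRingEnd ℂ (x : ℂ) := by
  let f : L →ₐ[ℚ] ℂ := (Complex.conjAe.restrictScalars ℚ).toAlgHom.comp L.val
  have hw : f ⟨omega, omega_mem⟩ = omega⁻¹ := by
    change starRingEnd ℂ omega = omega⁻¹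
    rw [omega, ← Complex.exp_conj, ← Complex.exp_neg]
    congr 1
    simp only [map_div₀, map_mul, map_ofNat, Complex.conj_ofReal, Complex.conj_I]
    ring
  have hth : f ⟨theta, theta_mem⟩ = theta := Complex.conj_ofReal _
  obtain ⟨s, hs⟩ := exists_aut f (by rw [hw]; exact inv_mem omega_mem)
    (by rw [hth]; exact theta_mem)
  exact ⟨s, hs⟩

/-- Complex conjugation on `L`. -/
def conjL : L ≃ₐ[ℚ] L := exists_conj.choose

theorem conjL_apply (x : L) : (conjL x : ℂ) = starRingEnd ℂ (x : ℂ) := exists_conj.choose_spec x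

/-- The conjugate ideal: the image of `I` under complex conjugation. -/
def conjIdeal (I : Ideal (𝓞 L)) : Ideal (𝓞 L) :=
  I.map (RingOfIntegers.mapRingEquiv conjL.toRingEquiv)

/-- The codeword matrix of `x₀ + x₁ e + ⋯ + x₅ e⁵` in the cyclic algebra `(L/ℚ(ω), σ, γ)`,
`e⁶ = γ = -ω`: the entry in row `i` and column `j` is `σ^i (x_{j-i})` for `i ≤ j` and
`γ σ^i (x_{j-i+6})` for `j < i`. (The index `j - i` below is taken modulo 6.) -/
def codeword (x : Fin 6 → 𝓞 L) : Matrix (Fin 6) (Fin 6) ℂ :=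
  Matrix.of fun i j =>
    (if j < i then -omega else 1) * (((sigma ^ (i : ℕ)) ((x (j - i) : 𝓞 L) : L) : L) : ℂ)

/-- The minimum determinant `δ(C)`: the minimum of `det ((X - X') (X - X')ᴴ)` over distinct
codewords (such a determinant is a nonnegative real number). -/
def minDet (C : Set (Matrix (Fin 6) (Fin 6) ℂ)) : ℝ :=
  sInf {d | ∃ X ∈ C, ∃ X' ∈ C, X ≠ X' ∧
    d = (Matrix.det ((X - X') * (X - X').conjTranspose)).re}

section Code

variable {K : ℕ} (I : Ideal (𝓞 L)) (q : Fin K → Ideal (𝓞 L))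

/-- The message tuples `(w₁, …, w_K)`: each `w_k = (w_{k,0}, …, w_{k,5})` lies in `(𝓞_L/𝔮_k)⁶`. -/
abbrev Messages : Type := ∀ k : Fin K, Fin 6 → 𝓞 L ⧸ q k

/-- The quotient `I / I𝔮`, where `𝔮 = 𝔮₁ ⋯ 𝔮_K`. -/
abbrev LayerQuotient : Type := I ⧸ (I * ∏ k, q k).submoduleOf I

/-- The layer map: an isomorphism `𝓞_L/𝔮₁ × ⋯ × 𝓞_L/𝔮_K ≅ I / I𝔮`. -/
abbrev LayerMap : Type := (∀ k : Fin K, 𝓞 L ⧸ q k) ≃ₗ[𝓞 L] LayerQuotient I q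

variable {I q}

/-- The codewords that carry the message tuple `w`: the layer `ℓ` is in the coset
`M (w_{1,ℓ}, …, w_{K,ℓ})` of `I𝔮` in `I`. -/
def encode (M : LayerMap I q) (w : Messages q) : Set (Matrix (Fin 6) (Fin 6) ℂ) :=
  {X | ∃ x : Fin 6 → I,
    (∀ l, (Submodule.Quotient.mk (x l) : LayerQuotient I q) = M fun k => w k l) ∧
    X = codeword fun l => (x l : 𝓞 L)}

/-- The layered space-time index code `C`. -/
def code (M : LayerMap I q) : Set (Matrix (Fin 6) (Fin 6) ℂ) := ⋃ w, encode M w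

/-- The subcode `C_S` for the side information `w_s = v_s`, `s ∈ S`. -/
def subcode (M : LayerMap I q) (S : Finset (Fin K)) (v : Messages q) :
    Set (Matrix (Fin 6) (Fin 6) ℂ) :=
  ⋃ w ∈ {w : Messages q | ∀ s ∈ S, w s = v s}, encode M w

variable (q)

/-- The rate of the message `w_k` in bits per real symbol: `log₂` of the number of its values, over
the `2 · 6²` real symbols of a codeword. -/
def rate (k : Fin K) : ℝ := Real.logb 2 (Nat.card (Fin 6 → 𝓞 L ⧸ q k)) / (2 * 6 ^ 2)

variable {q}

/-- The normalized side information gain `Γ(C, S)`, for `n_t = 6` transmit antennas. -/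
def gain (M : LayerMap I q) (S : Finset (Fin K)) (v : Messages q) : ℝ :=
  10 * Real.logb 10 (minDet (subcode M S v) / minDet (code M)) / (6 * ∑ s ∈ S, rate q s)

end Code

/-- The minimum of `N_{L/ℚ}(x)` over the nonzero `x ∈ I`. (`L` is totally complex, so that norms
are nonnegative and the absolute value changes nothing.) -/
def minNorm (I : Ideal (𝓞 L)) : ℕ :=
  sInf {m | ∃ x ∈ I, x ≠ 0 ∧ m = (Algebra.norm ℤ x).natAbs}

/-- The constant `γ_I = 20 log₁₀ (N(I) / min N_{L/ℚ}(x))`. -/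
def gammaI (I : Ideal (𝓞 L)) : ℝ :=
  20 * Real.logb 10 ((Ideal.absNorm I : ℝ) / (minNorm I : ℝ))

end

end SixBySix

/-!
Let `A` be the cyclic matrix over `𝓞 L` whose image in `ℂ` is the codeword of `x`. The prime
`P = (θ, ω - 2)` above 7 has residue field `𝔽₇`, so `σ` acts trivially modulo `P`. If `x ≠ 0` is
divided by a common factor until it no longer vanishes modulo `P`, then `A` reduces to the matrix of
multiplication by a nonzero element of the field `𝔽₇[X] / (X⁶ + ω)`, where `ω ≡ 2`; hence
`det A ≠ 0`.

Since `det A` is fixed by `σ`, its norm to `ℚ` is `|det A| ^ 12`. If the coordinates of `x` lie in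
an ideal `J`, then `det A` lies in `∏ σⁱ(J)`, which has norm `N(J)⁶`. So `N(J) ≤ |det A|²`, and with
`J = I 𝔮_S`, which contains the coordinates of differences of codewords with the same side
information, `N(I) N(𝔮_S) ≤ δ(C_S)`.

On the other hand `δ(C)` is at most the minimal norm `m` of `I`, by the codeword of `(a, 0, …, 0)`
with `N(a) = m`. As `12 ∑ R_s = log₂ N(𝔮_S) ≥ 1` and `N(I) ≤ m`, the logarithm of
`δ(C_S) / δ(C) ≥ (N(I) / m) N(𝔮_S)`, divided by `log₂ N(𝔮_S)`, is at least that of `2 N(I) / m`.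
-/

namespace SixBySix

open NumberField Polynomial

noncomputable section

/-! ### Determinants of cyclic matrices -/

section CyclicMatrix

variable {n : ℕ} {R : Type*} [CommRing R] (σ : R →+* R) (γ : R)

/-- The matrix of right multiplication by `x₀ + x₁ e + ⋯ + xₙ₋₁ eⁿ⁻¹` in the cyclic algebra
`(R, σ, γ)`, in which `e r = σ(r) e` and `eⁿ = γ`: row `i` lists the coefficients of
`eⁱ (x₀ + x₁ e + ⋯ + xₙ₋₁ eⁿ⁻¹)`. The difference `j - i` is taken modulo `n`. -/
def cyclicMatrix (x : Fin n → R) : Matrix (Fin n) (Fin n) R :=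
  Matrix.of fun i j => (if j < i then γ else 1) * (σ ^ (i : ℕ)) (x (j - i))

theorem cyclicMatrix_map {S : Type*} [CommRing S] {τ : S →+* S} (φ : R →+* S)
    (h : φ.comp σ = τ.comp φ) (x : Fin n → R) :
    (cyclicMatrix σ γ x).map φ = cyclicMatrix τ (φ γ) (φ ∘ x) := by
  have hsemiconj : Function.Semiconj φ σ τ := RingHom.congr_fun h
  have hpow (i : ℕ) (r : R) : φ ((σ ^ i) r) = (τ ^ i) (φ r) := by
    rw [RingHom.coe_pow, RingHom.coe_pow]
    exact hsemiconj.iterate_right i r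
  ext i j
  simp only [cyclicMatrix, Matrix.map_apply, Matrix.of_apply, map_mul, apply_ite φ, map_one, hpow,
    Function.comp_apply]

theorem cyclicMatrix_sub (x y : Fin n → R) :
    cyclicMatrix σ γ (x - y) = cyclicMatrix σ γ x - cyclicMatrix σ γ y := by
  ext i j
  simp only [cyclicMatrix, Matrix.of_apply, Matrix.sub_apply, Pi.sub_apply, map_sub, mul_sub]

theorem cyclicMatrix_smul (a : R) (x : Fin n → R) :
    cyclicMatrix σ γ (a • x) =
      Matrix.diagonal (fun i : Fin n => (σ ^ (i : ℕ)) a) * cyclicMatrix σ γ x := by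
  ext i j
  simp only [cyclicMatrix, Matrix.of_apply, Matrix.diagonal_mul, Pi.smul_apply, smul_eq_mul,
    map_mul, mul_left_comm]

theorem det_cyclicMatrix_smul (a : R) (x : Fin n → R) :
    (cyclicMatrix σ γ (a • x)).det =
      (∏ i : Fin n, (σ ^ (i : ℕ)) a) * (cyclicMatrix σ γ x).det := by
  rw [cyclicMatrix_smul, Matrix.det_mul, Matrix.det_diagonal]

theorem det_cyclicMatrix_single_zero [NeZero n] (a : R) :
    (cyclicMatrix σ γ (Pi.single (0 : Fin n) a)).det = ∏ i : Fin n, (σ ^ (i : ℕ)) a := by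
  rw [← Matrix.det_diagonal]
  congr 1
  ext i j
  rcases eq_or_ne i j with rfl | hij
  · simp [cyclicMatrix]
  · simp [cyclicMatrix, hij, sub_ne_zero.2 hij.symm]

theorem det_mem_prod_of_forall_mem {ι : Type*} [Fintype ι] [DecidableEq ι] {A : Matrix ι ι R}
    {J : ι → Ideal R} (h : ∀ i j, A i j ∈ J i) : A.det ∈ ∏ i, J i := by
  rw [← Matrix.det_transpose, Matrix.det_apply']
  exact Ideal.sum_mem _ fun p _ =>
    Ideal.mul_mem_left _ _ (Ideal.prod_mem_prod fun i _ => h i (p i))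

theorem det_cyclicMatrix_mem_prod {J : Ideal R} {x : Fin n → R} (hx : ∀ l, x l ∈ J) :
    (cyclicMatrix σ γ x).det ∈ ∏ i : Fin n, J.map (σ ^ (i : ℕ)) :=
  det_mem_prod_of_forall_mem fun i j =>
    Ideal.mul_mem_left _ _ (Ideal.mem_map_of_mem _ (hx (j - i)))

variable {σ γ}

theorem pow_val_add_one {G : Type*} [Monoid G] [NeZero n] {g : G} (hg : g ^ n = 1) (i : Fin n) :
    g ^ ((i + 1 : Fin n) : ℕ) = g * g ^ (i : ℕ) := by
  rw [Fin.val_add, Fin.val_one', Nat.add_mod_mod, ← pow_eq_pow_mod _ hg, pow_succ']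

/-- Conjugation by `e` preserves the determinant. It applies `σ` to all coordinates, so that
entrywise `σ` amounts to a cyclic shift of rows and columns, up to factors `γ`. -/
theorem map_det_cyclicMatrix [NeZero n] [IsDomain R] (hσ : σ ^ n = 1) (hσγ : σ γ = γ) (hγ : γ ≠ 0)
    (x : Fin n → R) : σ (cyclicMatrix σ γ x).det = (cyclicMatrix σ γ x).det := by
  let d : Fin n → R := fun i => if i + 1 = 0 then γ else 1
  have hd : (Matrix.diagonal d).det ≠ 0 := by
    rw [Matrix.det_diagonal, Finset.prod_ne_zero_iff]
    intro i _
    dsimp only [d]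
    split_ifs
    exacts [hγ, one_ne_zero]
  have hwrap (i j : Fin n) : (if j < i then γ else 1) * d j =
      d i * (if j + 1 < i + 1 then γ else 1) := by
    obtain ⟨m, rfl⟩ := Nat.exists_eq_succ_of_ne_zero (NeZero.ne n)
    simp only [d, Fin.lt_def, Fin.val_add_one, Fin.ext_iff, Fin.val_last]
    grind
  have hshift : σ.mapMatrix (cyclicMatrix σ γ x) * Matrix.diagonal d = Matrix.diagonal d *
      (cyclicMatrix σ γ x).submatrix (Equiv.addRight 1) (Equiv.addRight 1) := by
    ext i j
    simp only [cyclicMatrix, Matrix.mul_diagonal, Matrix.diagonal_mul, RingHom.mapMatrix_apply,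
      Matrix.map_apply, Matrix.of_apply, Matrix.submatrix_apply, Equiv.coe_addRight,
      add_sub_add_right_eq_sub, pow_val_add_one hσ, map_mul, apply_ite σ, hσγ, map_one,
      RingHom.mul_def, RingHom.comp_apply]
    rw [mul_right_comm, hwrap, mul_assoc]
  have hdet := congrArg Matrix.det hshift
  rw [Matrix.det_mul, Matrix.det_mul, Matrix.det_submatrix_equiv_self, mul_comm,
    ← RingHom.map_det] at hdet
  exact mul_left_cancel₀ hd hdet

theorem pow_mul_pow_val {A : Type*} [Monoid A] (a : A) (i l : Fin n) :
    a ^ (i : ℕ) * a ^ (l : ℕ) = (if i + l < i then a ^ n else 1) * a ^ ((i + l : Fin n) : ℕ) := by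
  rw [← pow_add, ite_mul, one_mul, ← pow_add]
  have := i.2
  have := l.2
  split_ifs with h <;> rw [Fin.lt_def, Fin.val_add_eq_ite] at h <;>
    rw [Fin.val_add_eq_ite] <;> congr 1 <;> grind

theorem sum_cyclicMatrix_one_smul_pow {A : Type*} [Ring A] [Algebra R A] {a : A}
    (ha : a ^ n = algebraMap R A γ) (c : Fin n → R) (i : Fin n) :
    ∑ j, cyclicMatrix 1 γ c i j • a ^ (j : ℕ) = a ^ (i : ℕ) * ∑ l, c l • a ^ (l : ℕ) := by
  have : NeZero n := ⟨by rintro rfl; exact i.elim0⟩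
  rw [Finset.mul_sum, ← Equiv.sum_comp (Equiv.addLeft i)]
  refine Finset.sum_congr rfl fun l _ => ?_
  rw [mul_smul_comm, pow_mul_pow_val, ha, Equiv.coe_addLeft, cyclicMatrix, Matrix.of_apply,
    add_sub_cancel_left, one_pow, RingHom.one_def, RingHom.id_apply, mul_comm, mul_smul]
  split_ifs <;> simp only [Algebra.smul_def, map_one, one_mul]

theorem det_cyclicMatrix_one_ne_zero {A : Type*} [IsDomain R] [Ring A] [NoZeroDivisors A]
    [Algebra R A] {a : A} (ha : a ^ n = algebraMap R A γ)
    (hli : LinearIndependent R fun i : Fin n => a ^ (i : ℕ)) {c : Fin n → R} (hc : c ≠ 0) :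
    (cyclicMatrix 1 γ c).det ≠ 0 := by
  intro hdet
  obtain ⟨v, hv, hvM⟩ := Matrix.exists_vecMul_eq_zero_iff.2 hdet
  have hprod : (∑ i, v i • a ^ (i : ℕ)) * ∑ l, c l • a ^ (l : ℕ) = 0 := by
    calc (∑ i, v i • a ^ (i : ℕ)) * ∑ l, c l • a ^ (l : ℕ)
        = ∑ i, v i • ∑ j, cyclicMatrix 1 γ c i j • a ^ (j : ℕ) := by
          simp only [sum_cyclicMatrix_one_smul_pow ha, Finset.sum_mul, smul_mul_assoc]
      _ = ∑ j, Matrix.vecMul v (cyclicMatrix 1 γ c) j • a ^ (j : ℕ) := by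
          simp only [Matrix.vecMul, dotProduct, Finset.smul_sum, Finset.sum_smul, mul_smul]
          exact Finset.sum_comm
      _ = 0 := by simp only [hvM, Pi.zero_apply, zero_smul, Finset.sum_const_zero]
  rw [Fintype.linearIndependent_iff] at hli
  rcases mul_eq_zero.1 hprod with h | h
  · exact hv (funext (hli v h))
  · exact hc (funext (hli c h))

theorem det_cyclicMatrix_one_ne_zero_of_irreducible {F : Type*} [Field F] {g : F}
    (hg : Irreducible (X ^ n - C g)) {c : Fin n → F} (hc : c ≠ 0) :
    (cyclicMatrix 1 g c).det ≠ 0 := by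
  have : Fact (Irreducible (X ^ n - C g)) := ⟨hg⟩
  have hli := (AdjoinRoot.powerBasis hg.ne_zero).basis.linearIndependent
  rw [PowerBasis.coe_basis, AdjoinRoot.powerBasis_gen] at hli
  exact det_cyclicMatrix_one_ne_zero (root_X_pow_sub_C_pow n g)
    (hli.comp (Fin.cast (by rw [AdjoinRoot.powerBasis_dim, natDegree_X_pow_sub_C]))
      (Fin.cast_injective _)) hc

theorem exists_smul_eq_smul_notMem [IsDedekindDomain R] {P : Ideal R} (hP : P ≠ ⊤) {ι : Type*}
    [Finite ι] {x : ι → R} (hx : x ≠ 0) :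
    ∃ (a b : R) (y : ι → R), a ≠ 0 ∧ a • y = b • x ∧ ∃ l, y l ∉ P := by
  have := Fintype.ofFinite ι
  obtain ⟨l, hl⟩ := Function.ne_iff.1 hx
  obtain ⟨t, ht, k, -, hk⟩ := Ideal.exist_integer_multiples_notMem hP Finset.univ
    (fun i => algebraMap R (FractionRing R) (x i)) (Finset.mem_univ l)
    ((map_ne_zero_iff _ (IsFractionRing.injective R (FractionRing R))).2 hl)
  choose! y hy using ht
  obtain ⟨b, a, ha, rfl⟩ := IsFractionRing.div_surjective (A := R) t
  refine ⟨a, b, y, nonZeroDivisors.ne_zero ha, ?_, k, fun hyP => hk ?_⟩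
  · ext i
    apply IsFractionRing.injective R (FractionRing R)
    have ha' := (map_ne_zero_iff _ (IsFractionRing.injective R (FractionRing R))).2
      (nonZeroDivisors.ne_zero ha)
    rw [Pi.smul_apply, Pi.smul_apply, smul_eq_mul, smul_eq_mul, map_mul, map_mul,
      hy i (Finset.mem_univ i)]
    field_simp
  · rw [← hy k (Finset.mem_univ k)]
    exact ⟨y k, hyP, rfl⟩

/-- After division by a common factor `x` does not vanish modulo `P`, where `σ` is trivial and the
cyclic algebra becomes the field `(R / P)[X] / (Xⁿ - γ)`. -/
theorem det_cyclicMatrix_ne_zero [IsDedekindDomain R] {P : Ideal R} [P.IsMaximal]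
    (hσ : Function.Injective σ) (hσP : ∀ r, σ r - r ∈ P)
    (hγ : Irreducible (X ^ n - C (Ideal.Quotient.mk P γ))) {x : Fin n → R} (hx : x ≠ 0) :
    (cyclicMatrix σ γ x).det ≠ 0 := by
  obtain ⟨a, b, y, ha, hab, l, hl⟩ :=
    exists_smul_eq_smul_notMem (Ideal.IsMaximal.ne_top ‹P.IsMaximal›) hx
  have hy : (cyclicMatrix σ γ y).det ≠ 0 := by
    let _ : Field (R ⧸ P) := Ideal.Quotient.field P
    have hcomp : (Ideal.Quotient.mk P).comp σ = RingHom.comp 1 (Ideal.Quotient.mk P) :=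
      RingHom.ext fun r => Ideal.Quotient.eq.2 (hσP r)
    have hc : Ideal.Quotient.mk P ∘ y ≠ 0 := fun h =>
      hl (Ideal.Quotient.eq_zero_iff_mem.1 (congrFun h l))
    intro hdet
    apply det_cyclicMatrix_one_ne_zero_of_irreducible hγ hc
    rw [← cyclicMatrix_map σ γ _ hcomp, ← RingHom.mapMatrix_apply, ← RingHom.map_det, hdet,
      map_zero]
  have ha' : ∏ i : Fin n, (σ ^ (i : ℕ)) a ≠ 0 := Finset.prod_ne_zero_iff.2 fun i _ => by
    rw [RingHom.coe_pow]
    exact (map_ne_zero_iff (σ ^ (i : ℕ)) (by rw [RingHom.coe_pow]; exact hσ.iterate i)).2 ha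
  intro hdet
  apply mul_ne_zero ha' hy
  rw [← det_cyclicMatrix_smul, hab, det_cyclicMatrix_smul, hdet, mul_zero]

end CyclicMatrix

theorem pow_card_pow_eq_mul {F A : Type*} [Field F] [CommRing A] [Algebra F A] {n m : ℕ} {g : F}
    {a : A} (hF : Nat.card F = n * m + 1) (ha : a ^ n = algebraMap F A g) (k : ℕ) :
    a ^ Nat.card F ^ k = algebraMap F A ((g ^ m) ^ k) * a := by
  induction k with
  | zero => simp only [pow_zero, pow_one, map_one, one_mul]
  | succ k ih =>
    have hfix : ((g ^ m) ^ k) ^ Nat.card F = (g ^ m) ^ k := by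
      have : Finite F := Nat.finite_of_card_ne_zero (by rw [hF]; exact Nat.succ_ne_zero _)
      have := Fintype.ofFinite F
      rw [Nat.card_eq_fintype_card, FiniteField.pow_card]
    rw [pow_succ, pow_mul, ih, mul_pow, ← map_pow, hfix, hF, pow_succ a, pow_mul, ha, ← map_pow,
      pow_succ (g ^ m), map_mul, mul_assoc]

/-- Let `a` be a root of an irreducible factor of degree `d`. As `a ^ |F| = g ^ m * a`, one has
`a = a ^ |F| ^ d = (g ^ m) ^ d * a` and hence `n ∣ d`. -/
theorem irreducible_X_pow_sub_C_of_orderOf {F : Type*} [Field F] {n m : ℕ} {g : F}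
    (hF : Nat.card F = n * m + 1) (hg : orderOf (g ^ m) = n) : Irreducible (X ^ n - C g) := by
  have : Finite F := Nat.finite_of_card_ne_zero (by rw [hF]; exact Nat.succ_ne_zero _)
  have hnm : n * m ≠ 0 := by have := Finite.one_lt_card (α := F); grind
  have hn : n ≠ 0 := left_ne_zero_of_mul hnm
  have hg0 : g ≠ 0 := by
    rintro rfl
    rw [zero_pow (right_ne_zero_of_mul hnm), orderOf_zero] at hg
    exact hn hg.symm
  obtain ⟨f, hf, hfd⟩ := exists_irreducible_of_natDegree_ne_zero (f := X ^ n - C g)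
    (by rwa [natDegree_X_pow_sub_C])
  have : Fact (Irreducible f) := ⟨hf⟩
  have hroot : AdjoinRoot.root f ^ n = algebraMap F (AdjoinRoot f) g := by
    have h := AdjoinRoot.mk_eq_zero.2 hfd
    rwa [map_sub, map_pow, AdjoinRoot.mk_X, AdjoinRoot.mk_C, sub_eq_zero] at h
  have hroot0 : AdjoinRoot.root f ≠ 0 := fun h =>
    hg0 <| (map_eq_zero (algebraMap F (AdjoinRoot f))).1 <| by rw [← hroot, h, zero_pow hn]
  have hfixed : AdjoinRoot.root f ^ Nat.card F ^ f.natDegree = AdjoinRoot.root f := by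
    have := (AdjoinRoot.powerBasis hf.ne_zero).finite
    have := Module.finite_of_finite F (M := AdjoinRoot f)
    have := Fintype.ofFinite (AdjoinRoot f)
    rw [← AdjoinRoot.powerBasis_dim hf.ne_zero, ← PowerBasis.finrank,
      ← Module.natCard_eq_pow_finrank, Nat.card_eq_fintype_card, FiniteField.pow_card]
  have hdvd : n ∣ f.natDegree := by
    rw [← hg, orderOf_dvd_iff_pow_eq_one, ← (algebraMap F (AdjoinRoot f)).injective.eq_iff, map_one]
    exact mul_right_cancel₀ hroot0 (by rw [← pow_card_pow_eq_mul hF hroot, hfixed, one_mul])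
  refine (associated_of_dvd_of_natDegree_le hfd (X_pow_sub_C_ne_zero hn.bot_lt g) ?_).irreducible hf
  rw [natDegree_X_pow_sub_C]
  exact Nat.le_of_dvd hf.natDegree_pos hdvd

/-! ### Ideals of Dedekind domains -/

section Ideals

variable {R : Type*} [CommRing R] [IsDedekindDomain R]

theorem mem_mul_prod_of_apply_mk_eq_zero {κ : Type*} [Fintype κ] {I : Ideal R} {q : κ → Ideal R}
    {f : (I ⧸ (I * ∏ k, q k).submoduleOf I) →ₗ[R] ∀ k, R ⧸ q k} (hf : Function.Injective f)
    {S : Finset κ} (hq : ∀ k ∉ S, q k ≠ ⊥) {z : I}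
    (hz : ∀ s ∈ S, f (Submodule.Quotient.mk z) s = 0) : (z : R) ∈ I * ∏ s ∈ S, q s := by
  classical
  have hle : Ideal.span {(z : R)} * ∏ k ∈ Sᶜ, q k ≤ (I * ∏ s ∈ S, q s) * ∏ k ∈ Sᶜ, q k := by
    rw [mul_assoc, Finset.prod_mul_prod_compl, Ideal.span_singleton_mul_le_iff]
    intro a ha
    have hfa : f (Submodule.Quotient.mk (a • z)) = 0 := by
      rw [Submodule.Quotient.mk_smul, map_smul]
      funext k
      by_cases hk : k ∈ S
      · rw [Pi.smul_apply, hz k hk, smul_zero, Pi.zero_apply]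
      · have hak : a ∈ q k := Ideal.le_of_dvd (Finset.dvd_prod_of_mem q (Finset.mem_compl.2 hk)) ha
        rw [Pi.smul_apply, Pi.zero_apply, Algebra.smul_def, Ideal.Quotient.algebraMap_eq,
          Ideal.Quotient.eq_zero_iff_mem.2 hak, zero_mul]
    rw [map_eq_zero_iff f hf, Submodule.Quotient.mk_eq_zero] at hfa
    rw [mul_comm (z : R)]
    exact hfa
  have hne : ∏ k ∈ Sᶜ, q k ≠ 0 :=
    Finset.prod_ne_zero_iff.2 fun k hk => hq k (Finset.mem_compl.1 hk)
  rwa [← Ideal.dvd_iff_le, mul_dvd_mul_iff_right hne, Ideal.dvd_iff_le,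
    Ideal.span_singleton_le_iff_mem] at hle

variable [Module.Free ℤ R]

theorem absNorm_map_of_bijective {R' F : Type*} [CommRing R'] [IsDedekindDomain R']
    [Module.Free ℤ R'] [FunLike F R R'] [RingHomClass F R R'] {f : F} (hf : Function.Bijective f)
    (I : Ideal R) : Ideal.absNorm (I.map f) = Ideal.absNorm I := by
  rw [Ideal.absNorm_apply, Ideal.absNorm_apply, Submodule.cardQuot_apply, Submodule.cardQuot_apply]
  exact (Nat.card_congr
    (Ideal.quotientEquiv I (I.map f) (RingEquiv.ofBijective f hf) rfl).toEquiv).symm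

theorem eq_of_le_of_absNorm_eq {I J : Ideal R} (hle : I ≤ J) (hJ : Ideal.absNorm J ≠ 0)
    (h : Ideal.absNorm I = Ideal.absNorm J) : I = J := by
  obtain ⟨A, rfl⟩ := Ideal.dvd_iff_le.2 hle
  rw [map_mul, Nat.mul_eq_left hJ, Ideal.absNorm_eq_one_iff] at h
  rw [h, Ideal.mul_top]

section Finite

variable [Module.Finite ℤ R]

theorem absNorm_pos {I : Ideal R} (hI : I ≠ ⊥) : 0 < Ideal.absNorm I :=
  Nat.pos_of_ne_zero fun h => hI (Ideal.absNorm_eq_zero_iff.1 h)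

theorem two_le_absNorm_prod {κ : Type*} {q : κ → Ideal R} {S : Finset κ} (hq : ∀ s ∈ S, q s ≠ ⊥)
    (hS : ∃ s ∈ S, q s ≠ ⊤) : 2 ≤ Ideal.absNorm (∏ s ∈ S, q s) := by
  obtain ⟨s, hs, htop⟩ := hS
  have hpos : 0 < Ideal.absNorm (∏ s ∈ S, q s) := absNorm_pos (Finset.prod_ne_zero_iff.2 hq)
  have hne : Ideal.absNorm (∏ s ∈ S, q s) ≠ 1 := by
    rw [map_prod, ne_eq, Finset.prod_eq_one_iff]
    exact fun h => htop (Ideal.absNorm_eq_one_iff.1 (h s hs))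
  omega

theorem absNorm_le_natAbs_norm {I : Ideal R} {x : R} (hx : x ∈ I) (hx0 : x ≠ 0) :
    Ideal.absNorm I ≤ (Algebra.norm ℤ x).natAbs := by
  rw [← Ideal.absNorm_span_singleton]
  exact Nat.le_of_dvd (absNorm_pos (mt Ideal.span_singleton_eq_bot.1 hx0))
    (Ideal.absNorm_dvd_absNorm_of_le ((Ideal.span_singleton_le_iff_mem I).2 hx))

end Finite

theorem exists_intCast_sub_mem {p : ℕ} [Fact p.Prime] {P : Ideal R} (hP : Ideal.absNorm P = p)
    (x : R) : ∃ m : ℤ, x - m ∈ P := by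
  have hcard : Nat.card (R ⧸ P) = p := by
    rw [← hP, Ideal.absNorm_apply, Submodule.cardQuot_apply]
  have : Nontrivial (R ⧸ P) := by
    rw [Ideal.Quotient.nontrivial_iff, ne_eq, ← Ideal.absNorm_eq_one_iff, hP]
    exact (Fact.out : p.Prime).ne_one
  obtain ⟨m, hm⟩ := AddSubgroup.mem_zmultiples_iff.1
    (mem_zmultiples_of_prime_card hcard (one_ne_zero : (1 : R ⧸ P) ≠ 0)
      (g' := Ideal.Quotient.mk P x))
  refine ⟨m, ?_⟩
  rw [← Ideal.Quotient.mk_eq_mk_iff_sub_mem, ← hm]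
  simp

end Ideals

/-! ### The Galois group of `L` -/

/-- `ω` as an element of `L`. -/
def omegaL : L := ⟨omega, omega_mem⟩

/-- `θ` as an element of `L`. -/
def thetaL : L := ⟨theta, theta_mem⟩

theorem omega_primitive : IsPrimitiveRoot omega 3 := by
  rw [← zeta84_pow_28]
  exact zeta84_primitive.pow (by norm_num) rfl

theorem omegaL_sq_add : omegaL ^ 2 + omegaL + 1 = 0 := by
  have h := omega_primitive.geom_sum_eq_zero (by norm_num)
  simp only [Finset.sum_range_succ, Finset.sum_range_zero] at h
  have : omega ^ 2 + omega + 1 = 0 := by linear_combination h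
  exact Subtype.ext this

theorem omegaL_sq_ne : omegaL ^ 2 ≠ omegaL := by
  intro h
  have h1 : omega = 1 := by
    have h : omega ^ 2 = omega := congrArg Subtype.val h
    exact mul_left_cancel₀ (omega_primitive.ne_zero (by norm_num)) (by linear_combination h)
  exact omega_primitive.ne_one (by norm_num) h1

theorem zeta28_pow_fourteen : zeta28 ^ 14 = -1 := by
  rw [zeta28, ← Complex.exp_nat_mul, ← Complex.exp_pi_mul_I]
  congr 1; push_cast; ring

theorem add_inv_pow_three {F : Type*} [Field F] {z : F} (hz : z ≠ 0) :
    z ^ 3 + (z ^ 3)⁻¹ = (z + z⁻¹) ^ 3 - 3 * (z + z⁻¹) := by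
  field_simp
  ring

theorem add_inv_pow_five {F : Type*} [Field F] {z : F} (hz : z ≠ 0) :
    z ^ 5 + (z ^ 5)⁻¹ = (z + z⁻¹) ^ 5 - 5 * (z + z⁻¹) ^ 3 + 5 * (z + z⁻¹) := by
  field_simp
  ring

theorem add_inv_pow_seven {F : Type*} [Field F] {z : F} (hz : z ≠ 0) :
    z ^ 7 + (z ^ 7)⁻¹ =
      (z + z⁻¹) * ((z + z⁻¹) ^ 6 - 7 * (z + z⁻¹) ^ 4 + 14 * (z + z⁻¹) ^ 2 - 7) := by
  field_simp
  ring

theorem thetaL_ne_zero : thetaL ≠ 0 := by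
  intro h
  have h0 : 2 * Real.cos (Real.pi / 14) = 0 := Complex.ofReal_eq_zero.1 (congrArg Subtype.val h)
  have hpos : 0 < Real.cos (Real.pi / 14) := Real.cos_pos_of_mem_Ioo
    ⟨by linarith [Real.pi_pos], by linarith [Real.pi_pos]⟩
  linarith

theorem thetaL_sq_ne_four : thetaL ^ 2 ≠ 4 := by
  intro h
  have h4 : (2 * Real.cos (Real.pi / 14)) ^ 2 = 4 := by
    have h : (((2 * Real.cos (Real.pi / 14)) : ℝ) : ℂ) ^ 2 = 4 := congrArg Subtype.val h
    exact_mod_cast h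
  have hpos : 0 < Real.sin (Real.pi / 14) := Real.sin_pos_of_pos_of_lt_pi
    (by linarith [Real.pi_pos]) (by linarith [Real.pi_pos])
  nlinarith [Real.sin_sq_add_cos_sq (Real.pi / 14)]

theorem thetaL_poly : thetaL ^ 6 - 7 * thetaL ^ 4 + 14 * thetaL ^ 2 - 7 = 0 := by
  have h7 : zeta28 ^ 7 + (zeta28 ^ 7)⁻¹ = 0 := by
    have hne := pow_ne_zero 7 zeta28_ne_zero
    apply mul_left_cancel₀ hne
    rw [mul_add, mul_inv_cancel₀ hne]
    linear_combination zeta28_pow_fourteen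
  rw [add_inv_pow_seven zeta28_ne_zero, ← theta_eq] at h7
  have h : thetaL * (thetaL ^ 6 - 7 * thetaL ^ 4 + 14 * thetaL ^ 2 - 7) = 0 := Subtype.ext h7
  exact (mul_eq_zero.1 h).resolve_left thetaL_ne_zero

theorem sigma_omegaL : sigma omegaL = omegaL := Subtype.ext sigma_omega

theorem sigma_pow_omegaL (k : ℕ) : (sigma ^ k) omegaL = omegaL := by
  rw [AlgEquiv.coe_pow, Function.iterate_fixed sigma_omegaL]

theorem sigma_thetaL : sigma thetaL = thetaL ^ 5 - 5 * thetaL ^ 3 + 5 * thetaL := by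
  apply Subtype.ext
  change (sigma ⟨theta, theta_mem⟩ : ℂ) = theta ^ 5 - 5 * theta ^ 3 + 5 * theta
  rw [sigma_theta, add_inv_pow_five zeta28_ne_zero, theta_eq]

theorem coe_sigma_pow_thetaL (k : ℕ) :
    ((sigma ^ k) thetaL : ℂ) = zeta28 ^ 5 ^ k + (zeta28 ^ 5 ^ k)⁻¹ := by
  induction k with
  | zero => rw [pow_zero, pow_zero, pow_one, ← theta_eq]; rfl
  | succ k ih =>
    have h : (sigma ^ (k + 1)) thetaL =
        (sigma ^ k) thetaL ^ 5 - 5 * (sigma ^ k) thetaL ^ 3 + 5 * (sigma ^ k) thetaL := by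
      rw [pow_succ, AlgEquiv.mul_apply, sigma_thetaL]
      simp only [map_add, map_sub, map_mul, map_pow, map_ofNat]
    calc ((sigma ^ (k + 1)) thetaL : ℂ)
        = ((sigma ^ k) thetaL : ℂ) ^ 5 - 5 * ((sigma ^ k) thetaL : ℂ) ^ 3 +
            5 * ((sigma ^ k) thetaL : ℂ) := congrArg Subtype.val h
      _ = zeta28 ^ 5 ^ (k + 1) + (zeta28 ^ 5 ^ (k + 1))⁻¹ := by
          rw [ih, ← add_inv_pow_five (pow_ne_zero _ zeta28_ne_zero), ← pow_mul, ← pow_succ]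

theorem sigma_sq_thetaL : (sigma ^ 2) thetaL = thetaL ^ 3 - 3 * thetaL := by
  have h : zeta28 ^ 5 ^ 2 = (zeta28 ^ 3)⁻¹ := by
    rw [← mul_eq_one_iff_eq_inv₀ (pow_ne_zero 3 zeta28_ne_zero)]
    linear_combination (zeta28 ^ 14 - 1) * zeta28_pow_fourteen
  apply Subtype.ext
  change _ = theta ^ 3 - 3 * theta
  rw [coe_sigma_pow_thetaL, h, inv_inv, add_comm, add_inv_pow_three zeta28_ne_zero, ← theta_eq]

theorem sigma_pow_three_thetaL : (sigma ^ 3) thetaL = -thetaL := by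
  have h : zeta28 ^ 5 ^ 3 = -zeta28⁻¹ := by
    rw [← mul_right_inj' zeta28_ne_zero, mul_neg, mul_inv_cancel₀ zeta28_ne_zero]
    calc zeta28 * zeta28 ^ 5 ^ 3 = (zeta28 ^ 14) ^ 9 := by ring
      _ = -1 := by rw [zeta28_pow_fourteen]; norm_num
  apply Subtype.ext
  change _ = -theta
  rw [coe_sigma_pow_thetaL, h, theta_eq, inv_neg, inv_inv]
  ring

theorem aut_ext {s t : L ≃ₐ[ℚ] L} (homega : s omegaL = t omegaL) (htheta : s thetaL = t thetaL) :
    s = t := by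
  have h : (s : L →ₐ[ℚ] L) = t := by
    apply IntermediateField.adjoin_algHom_ext
    rintro x (rfl | rfl)
    exacts [homega, htheta]
  exact AlgEquiv.ext fun x => congrArg (fun f : L →ₐ[ℚ] L => f x) h

theorem sigma_pow_six : sigma ^ 6 = 1 := by
  apply aut_ext
  · exact sigma_pow_omegaL 6
  · rw [show 6 = 3 + 3 from rfl, pow_add, AlgEquiv.mul_apply, sigma_pow_three_thetaL, map_neg,
      sigma_pow_three_thetaL, neg_neg, AlgEquiv.one_apply]

theorem orderOf_sigma : orderOf sigma = 6 := by
  apply orderOf_eq_of_pow_and_pow_div_prime (by norm_num) sigma_pow_six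
  intro p hp hdvd h
  have hp23 : p = 2 ∨ p = 3 := by
    rwa [show 6 = 2 * 3 from rfl, hp.dvd_mul, Nat.prime_dvd_prime_iff_eq hp Nat.prime_two,
      Nat.prime_dvd_prime_iff_eq hp Nat.prime_three] at hdvd
  rcases hp23 with rfl | rfl
  · have h3 := sigma_pow_three_thetaL
    rw [show sigma ^ 3 = 1 from h, AlgEquiv.one_apply] at h3
    exact thetaL_ne_zero (self_eq_neg.1 h3)
  · have h2 := sigma_sq_thetaL
    rw [show sigma ^ 2 = 1 from h, AlgEquiv.one_apply] at h2
    exact thetaL_sq_ne_four (mul_left_cancel₀ thetaL_ne_zero (by linear_combination -h2))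

theorem conjL_omegaL : conjL omegaL = omegaL ^ 2 := by
  apply Subtype.ext
  rw [conjL_apply]
  change starRingEnd ℂ omega = omega ^ 2
  rw [← Complex.inv_eq_conj (omega_primitive.norm'_eq_one (by norm_num))]
  exact inv_eq_of_mul_eq_one_right (by rw [← pow_succ', omega_primitive.pow_eq_one])

theorem conjL_thetaL : conjL thetaL = thetaL := by
  apply Subtype.ext
  rw [conjL_apply]
  exact Complex.conj_ofReal _

theorem finrank_adjoin_simple_le {F E : Type*} [Field F] [Field E] [Algebra F E] {x : E} {p : F[X]}
    (hp : p ≠ 0) (hx : aeval x p = 0) :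
    Module.finrank F (IntermediateField.adjoin F {x}) ≤ p.natDegree := by
  have hint : IsIntegral F x := isAlgebraic_iff_isIntegral.1 ⟨p, hp, hx⟩
  rw [IntermediateField.adjoin.finrank hint]
  exact natDegree_le_of_dvd (minpoly.dvd F x hx) hp

theorem finrank_L_le : Module.finrank ℚ L ≤ 12 := by
  have hL : L = IntermediateField.adjoin ℚ {omega} ⊔ IntermediateField.adjoin ℚ {theta} := by
    rw [← IntermediateField.adjoin_union, Set.singleton_union]
  have homega : Module.finrank ℚ (IntermediateField.adjoin ℚ {omega}) ≤ 2 := by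
    have hdeg : (X ^ 2 + X + 1 : ℚ[X]).natDegree = 2 := by compute_degree!
    rw [← hdeg]
    refine finrank_adjoin_simple_le (ne_zero_of_natDegree_gt (n := 0) (by omega)) ?_
    simp only [map_add, map_pow, map_one, aeval_X]
    exact congrArg Subtype.val omegaL_sq_add
  have htheta : Module.finrank ℚ (IntermediateField.adjoin ℚ {theta}) ≤ 6 := by
    have hdeg : (X ^ 6 - 7 * X ^ 4 + 14 * X ^ 2 - 7 : ℚ[X]).natDegree = 6 := by compute_degree!
    rw [← hdeg]
    refine finrank_adjoin_simple_le (ne_zero_of_natDegree_gt (n := 0) (by omega)) ?_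
    simp only [map_add, map_sub, map_mul, map_pow, aeval_X, map_ofNat]
    exact congrArg Subtype.val thetaL_poly
  rw [hL]
  exact (IntermediateField.finrank_sup_le _ _).trans (Nat.mul_le_mul homega htheta)

/-- The twelve automorphisms of `L`: `σ^i`, and `σ^i` followed by complex conjugation. -/
def galoisElement (p : Fin 2 × Fin 6) : L ≃ₐ[ℚ] L := conjL ^ (p.1 : ℕ) * sigma ^ (p.2 : ℕ)

theorem galoisElement_injective : Function.Injective galoisElement := by
  rintro ⟨j, i⟩ ⟨j', i'⟩ h
  obtain rfl : j = j' := by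
    have homega := congrArg (fun s : L ≃ₐ[ℚ] L => s omegaL) h
    simp only [galoisElement, AlgEquiv.mul_apply, sigma_pow_omegaL] at homega
    fin_cases j <;> fin_cases j' <;>
      simp [conjL_omegaL, omegaL_sq_ne, omegaL_sq_ne.symm] at homega ⊢
  have hpow : sigma ^ (i : ℕ) = sigma ^ (i' : ℕ) := mul_left_cancel h
  have hi : (i : ℕ) = i' := pow_injOn_Iio_orderOf (by simp [orderOf_sigma])
    (by simp [orderOf_sigma]) hpow
  rw [Fin.ext hi]

theorem finrank_L : Module.finrank ℚ L = 12 :=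
  finrank_L_le.antisymm
    ((Fintype.card_le_of_injective _ galoisElement_injective).trans AlgEquiv.card_le)

theorem galoisElement_bijective : Function.Bijective galoisElement :=
  galoisElement_injective.bijective_of_nat_card_le (by
    rw [Nat.card_eq_fintype_card, Nat.card_eq_fintype_card]
    exact AlgEquiv.card_le.trans finrank_L.le)

instance : IsGalois ℚ L := by
  apply IsGalois.of_card_aut_eq_finrank
  rw [finrank_L, ← Nat.card_eq_of_bijective _ galoisElement_bijective, Nat.card_eq_fintype_card]
  rfl

theorem norm_eq_normSq_prod_sigma (x : L) : ((Algebra.norm ℚ x : ℚ) : ℝ) =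
    Complex.normSq ((∏ i : Fin 6, (sigma ^ (i : ℕ)) x : L) : ℂ) := by
  have h : algebraMap ℚ L (Algebra.norm ℚ x) =
      (∏ i : Fin 6, (sigma ^ (i : ℕ)) x) * conjL (∏ i : Fin 6, (sigma ^ (i : ℕ)) x) := by
    rw [Algebra.norm_eq_prod_automorphisms, ← galoisElement_bijective.prod_comp,
      Fintype.prod_prod_type, Fin.prod_univ_two, map_prod]
    rfl
  apply Complex.ofReal_injective
  rw [← Complex.mul_conj, ← conjL_apply, ← IntermediateField.coe_mul, ← h]
  simp

/-! ### The prime `(θ, ω - 2)` above 7 -/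

/-- `ω` as an element of the ring of integers of `L`. -/
def omegaO : 𝓞 L :=
  ⟨omegaL, X ^ 2 + X + 1, by monicity!, by simpa using omegaL_sq_add⟩

/-- `θ` as an element of the ring of integers of `L`. -/
def thetaO : 𝓞 L :=
  ⟨thetaL, X ^ 6 - 7 * X ^ 4 + 14 * X ^ 2 - 7, by monicity!, by simpa using thetaL_poly⟩

/-- The restriction of `σ` to the ring of integers of `L`. -/
def sigmaO : 𝓞 L →+* 𝓞 L := RingOfIntegers.mapRingHom (sigma : L →+* L)

theorem omegaO_sq_add : omegaO ^ 2 + omegaO + 1 = 0 := RingOfIntegers.ext omegaL_sq_add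

theorem omegaO_ne_zero : omegaO ≠ 0 := by
  intro h
  simpa [h] using omegaO_sq_add

theorem thetaO_poly : thetaO ^ 6 - 7 * thetaO ^ 4 + 14 * thetaO ^ 2 - 7 = 0 :=
  RingOfIntegers.ext thetaL_poly

theorem coe_sigmaO_pow (k : ℕ) (x : 𝓞 L) : ((sigmaO ^ k) x : L) = (sigma ^ k) (x : L) := by
  rw [RingHom.coe_pow, AlgEquiv.coe_pow]
  exact (Function.Semiconj.iterate_right (f := ((↑) : 𝓞 L → L)) (fun _ => rfl) k).eq x

theorem sigmaO_pow_six : sigmaO ^ 6 = 1 := by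
  ext x
  rw [coe_sigmaO_pow, sigma_pow_six]
  rfl

theorem sigmaO_pow_bijective (k : ℕ) : Function.Bijective (sigmaO ^ k) := by
  rw [RingHom.coe_pow]
  exact (RingOfIntegers.mapRingEquiv sigma.toRingEquiv).bijective.iterate k

theorem sigmaO_omegaO : sigmaO omegaO = omegaO := RingOfIntegers.ext sigma_omegaL

theorem sigmaO_thetaO : sigmaO thetaO = thetaO ^ 5 - 5 * thetaO ^ 3 + 5 * thetaO :=
  RingOfIntegers.ext sigma_thetaL

theorem isUnit_thetaO_sq_sub_one : IsUnit (thetaO ^ 2 - 1) :=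
  IsUnit.of_mul_eq_one (-(thetaO ^ 4 - 6 * thetaO ^ 2 + 8))
    (by linear_combination -thetaO_poly)

theorem span_thetaO_pow_six : Ideal.span {thetaO} ^ 6 = Ideal.span {((7 : ℕ) : 𝓞 L)} := by
  have h : thetaO ^ 6 = ((7 : ℕ) : 𝓞 L) * (thetaO ^ 2 - 1) ^ 2 := by
    push_cast
    linear_combination thetaO_poly
  rw [Ideal.span_singleton_pow, h,
    Ideal.span_singleton_mul_right_unit (isUnit_thetaO_sq_sub_one.pow 2)]

theorem absNorm_span_thetaO : Ideal.absNorm (Ideal.span {thetaO}) = 7 ^ 2 := by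
  apply Nat.pow_left_injective (by norm_num : 6 ≠ 0)
  dsimp only
  rw [← map_pow, span_thetaO_pow_six, Ideal.absNorm_span_natCast, RingOfIntegers.rank, finrank_L,
    ← pow_mul]

/-- The prime `(θ, ω - 2)` of `L`. It lies above 7, and `σ` acts trivially on its residue field. -/
def primeAboveSeven : Ideal (𝓞 L) := Ideal.span {thetaO, omegaO - 2}

theorem conjIdeal_primeAboveSeven :
    conjIdeal primeAboveSeven = Ideal.span {thetaO, omegaO ^ 2 - 2} := by
  have htheta : RingOfIntegers.mapRingEquiv conjL.toRingEquiv thetaO = thetaO :=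
    RingOfIntegers.ext conjL_thetaL
  have homega : RingOfIntegers.mapRingEquiv conjL.toRingEquiv omegaO = omegaO ^ 2 :=
    RingOfIntegers.ext conjL_omegaL
  rw [conjIdeal, primeAboveSeven, Ideal.map_span, Set.image_pair, map_sub, map_ofNat, htheta,
    homega]

theorem primeAboveSeven_mul_conjIdeal :
    primeAboveSeven * conjIdeal primeAboveSeven = Ideal.span {thetaO} := by
  rw [conjIdeal_primeAboveSeven, primeAboveSeven, Ideal.span_pair_mul_span_pair]
  have hseven : (omegaO - 2) * (omegaO ^ 2 - 2) = 7 := by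
    linear_combination (omegaO - 3) * omegaO_sq_add
  apply le_antisymm
  · rw [Ideal.span_le]
    rintro x (rfl | rfl | rfl | rfl) <;> rw [SetLike.mem_coe, Ideal.mem_span_singleton]
    · exact dvd_mul_right _ _
    · exact dvd_mul_right _ _
    · exact dvd_mul_left _ _
    · exact ⟨thetaO ^ 5 - 7 * thetaO ^ 3 + 14 * thetaO, by
        linear_combination hseven - thetaO_poly⟩
  · rw [Ideal.span_singleton_le_iff_mem]
    have hmem : -3 * (thetaO * (omegaO ^ 2 - 2)) + (-3 * ((omegaO - 2) * thetaO) +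
        -2 * thetaO * ((omegaO - 2) * (omegaO ^ 2 - 2))) ∈ Ideal.span {thetaO * thetaO,
        thetaO * (omegaO ^ 2 - 2), (omegaO - 2) * thetaO, (omegaO - 2) * (omegaO ^ 2 - 2)} :=
      add_mem (Ideal.mul_mem_left _ _ (Ideal.subset_span (by simp)))
        (add_mem (Ideal.mul_mem_left _ _ (Ideal.subset_span (by simp)))
          (Ideal.mul_mem_left _ _ (Ideal.subset_span (by simp))))
    convert hmem using 1
    linear_combination (2 * thetaO) * hseven + 3 * thetaO * omegaO_sq_add

theorem absNorm_primeAboveSeven : Ideal.absNorm primeAboveSeven = 7 := by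
  have h := congrArg Ideal.absNorm primeAboveSeven_mul_conjIdeal
  rw [map_mul, conjIdeal, absNorm_map_of_bijective (RingEquiv.bijective _), absNorm_span_thetaO,
    ← pow_two] at h
  exact Nat.pow_left_injective two_ne_zero h

instance : primeAboveSeven.IsMaximal := by
  have hprime : Irreducible (Ideal.absNorm primeAboveSeven) := by
    rw [absNorm_primeAboveSeven]
    exact Nat.prime_seven
  refine (Ideal.isPrime_of_irreducible_absNorm hprime).isMaximal ?_
  intro h
  simpa [h] using absNorm_primeAboveSeven

theorem sigmaO_mem_primeAboveSeven {x : 𝓞 L} (hx : x ∈ primeAboveSeven) :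
    sigmaO x ∈ primeAboveSeven := by
  suffices h : primeAboveSeven ≤ primeAboveSeven.comap sigmaO from h hx
  rw [primeAboveSeven, Ideal.span_le]
  rintro y (rfl | rfl) <;> rw [SetLike.mem_coe, Ideal.mem_comap]
  · rw [sigmaO_thetaO, show thetaO ^ 5 - 5 * thetaO ^ 3 + 5 * thetaO =
      (thetaO ^ 4 - 5 * thetaO ^ 2 + 5) * thetaO by ring]
    exact Ideal.mul_mem_left _ _ (Ideal.subset_span (by simp))
  · rw [map_sub, map_ofNat, sigmaO_omegaO]
    exact Ideal.subset_span (by simp)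

theorem sigmaO_sub_mem_primeAboveSeven (x : 𝓞 L) : sigmaO x - x ∈ primeAboveSeven := by
  have : Fact (Nat.Prime 7) := ⟨Nat.prime_seven⟩
  obtain ⟨m, hm⟩ := exists_intCast_sub_mem absNorm_primeAboveSeven x
  have h := sub_mem (sigmaO_mem_primeAboveSeven hm) hm
  rwa [map_sub, map_intCast, sub_sub_sub_cancel_right] at h

theorem irreducible_X_pow_six_sub_C_neg_omegaO :
    Irreducible (X ^ 6 - C (Ideal.Quotient.mk primeAboveSeven (-omegaO))) := by
  let _ : Field (𝓞 L ⧸ primeAboveSeven) := Ideal.Quotient.field _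
  have hcard : Nat.card (𝓞 L ⧸ primeAboveSeven) = 7 := by
    rw [← absNorm_primeAboveSeven, Ideal.absNorm_apply, Submodule.cardQuot_apply]
  apply irreducible_X_pow_sub_C_of_orderOf (m := 1) hcard
  have hroot : (cyclotomic 6 _).IsRoot (Ideal.Quotient.mk primeAboveSeven (-omegaO)) := by
    have h := congrArg (Ideal.Quotient.mk primeAboveSeven) omegaO_sq_add
    rw [map_add, map_add, map_pow, map_one, map_zero] at h
    rw [cyclotomic_six, IsRoot.def]
    simp only [eval_add, eval_sub, eval_pow, eval_X, eval_one, map_neg]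
    linear_combination h
  have : NeZero ((6 : ℕ) : 𝓞 L ⧸ primeAboveSeven) := by
    refine ⟨fun h6 => one_ne_zero (α := 𝓞 L ⧸ primeAboveSeven) ?_⟩
    have h7 := Ideal.Quotient.eq_zero_iff_mem.2 (Ideal.absNorm_mem primeAboveSeven)
    rw [absNorm_primeAboveSeven, map_natCast] at h7
    push_cast at h6 h7
    linear_combination h7 - h6
  rw [pow_one, ← (isRoot_cyclotomic_iff.1 hroot).eq_orderOf]

theorem det_cyclicMatrix_sigmaO_ne_zero {x : Fin 6 → 𝓞 L} (hx : x ≠ 0) :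
    (cyclicMatrix sigmaO (-omegaO) x).det ≠ 0 :=
  det_cyclicMatrix_ne_zero (sigmaO_pow_bijective 1).1 sigmaO_sub_mem_primeAboveSeven
    irreducible_X_pow_six_sub_C_neg_omegaO hx

/-! ### Determinants of codewords -/

theorem codeword_eq_map (x : Fin 6 → 𝓞 L) :
    codeword x = (cyclicMatrix sigmaO (-omegaO) x).map (algebraMap (𝓞 L) ℂ) := by
  ext i j
  rw [codeword, cyclicMatrix, Matrix.map_apply, Matrix.of_apply, Matrix.of_apply, map_mul,
    apply_ite (algebraMap (𝓞 L) ℂ), map_neg, map_one, ← coe_sigmaO_pow]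
  rfl

theorem det_codeword (x : Fin 6 → 𝓞 L) :
    (codeword x).det = algebraMap (𝓞 L) ℂ (cyclicMatrix sigmaO (-omegaO) x).det := by
  rw [codeword_eq_map, RingHom.map_det, RingHom.mapMatrix_apply]

theorem codeword_sub (x y : Fin 6 → 𝓞 L) : codeword (x - y) = codeword x - codeword y := by
  simp only [codeword_eq_map, cyclicMatrix_sub, Matrix.map_sub _ (map_sub (algebraMap (𝓞 L) ℂ))]

theorem codeword_injective : Function.Injective codeword := by
  intro x y h
  by_contra hxy
  apply det_cyclicMatrix_sigmaO_ne_zero (sub_ne_zero.2 hxy)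
  apply FaithfulSMul.algebraMap_injective (𝓞 L) ℂ
  rw [← det_codeword, codeword_sub, h, sub_self, Matrix.det_zero, map_zero]

theorem natAbs_norm_eq_normSq_prod_sigmaO (a : 𝓞 L) : ((Algebra.norm ℤ a).natAbs : ℝ) =
    Complex.normSq (algebraMap (𝓞 L) ℂ (∏ i : Fin 6, (sigmaO ^ (i : ℕ)) a)) := by
  have h : ((Algebra.norm ℤ a : ℤ) : ℝ) =
      Complex.normSq (algebraMap (𝓞 L) ℂ (∏ i : Fin 6, (sigmaO ^ (i : ℕ)) a)) := by
    rw [IsScalarTower.algebraMap_apply (𝓞 L) L ℂ, map_prod]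
    simp only [coe_sigmaO_pow]
    rw [← Rat.cast_intCast, Algebra.coe_norm_int, norm_eq_normSq_prod_sigma]
    rfl
  rw [Nat.cast_natAbs, Int.cast_abs, h, abs_of_nonneg (Complex.normSq_nonneg _)]

theorem normSq_det_codeword_single (a : 𝓞 L) :
    Complex.normSq (codeword (Pi.single 0 a)).det = (Algebra.norm ℤ a).natAbs := by
  rw [det_codeword, det_cyclicMatrix_single_zero, natAbs_norm_eq_normSq_prod_sigmaO]

theorem natAbs_norm_det_cyclicMatrix_sigmaO (x : Fin 6 → 𝓞 L) :
    ((Algebra.norm ℤ (cyclicMatrix sigmaO (-omegaO) x).det).natAbs : ℝ) =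
      Complex.normSq (codeword x).det ^ 6 := by
  have hdet : sigmaO (cyclicMatrix sigmaO (-omegaO) x).det =
      (cyclicMatrix sigmaO (-omegaO) x).det :=
    map_det_cyclicMatrix sigmaO_pow_six (by rw [map_neg, sigmaO_omegaO])
      (neg_ne_zero.2 omegaO_ne_zero) x
  simp only [natAbs_norm_eq_normSq_prod_sigmaO, RingHom.coe_pow, Function.iterate_fixed hdet,
    Finset.prod_const, Finset.card_univ, Fintype.card_fin, map_pow, det_codeword]

theorem absNorm_le_normSq_det_codeword {J : Ideal (𝓞 L)} {x : Fin 6 → 𝓞 L} (hx : ∀ l, x l ∈ J)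
    (hx0 : x ≠ 0) : (Ideal.absNorm J : ℝ) ≤ Complex.normSq (codeword x).det := by
  have hle := absNorm_le_natAbs_norm (det_cyclicMatrix_mem_prod sigmaO (-omegaO) hx)
    (det_cyclicMatrix_sigmaO_ne_zero hx0)
  simp only [map_prod, absNorm_map_of_bijective (sigmaO_pow_bijective _), Finset.prod_const,
    Finset.card_univ, Fintype.card_fin] at hle
  refine le_of_pow_le_pow_left₀ (n := 6) (by norm_num) (Complex.normSq_nonneg _) ?_
  rw [← natAbs_norm_det_cyclicMatrix_sigmaO]
  exact_mod_cast hle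

/-! ### Minimum determinants -/

theorem re_det_mul_conjTranspose {ι : Type*} [Fintype ι] [DecidableEq ι] (A : Matrix ι ι ℂ) :
    (A * A.conjTranspose).det.re = Complex.normSq A.det := by
  rw [Matrix.det_mul, Matrix.det_conjTranspose, Complex.star_def, Complex.mul_conj,
    Complex.ofReal_re]

theorem minDet_le {C : Set (Matrix (Fin 6) (Fin 6) ℂ)} {X X' : Matrix (Fin 6) (Fin 6) ℂ}
    (hX : X ∈ C) (hX' : X' ∈ C) (h : X ≠ X') : minDet C ≤ Complex.normSq (X - X').det := by
  refine csInf_le ⟨0, ?_⟩ ⟨X, hX, X', hX', h, (re_det_mul_conjTranspose _).symm⟩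
  rintro d ⟨Y, -, Y', -, -, rfl⟩
  rw [re_det_mul_conjTranspose]
  exact Complex.normSq_nonneg _

theorem le_minDet {C : Set (Matrix (Fin 6) (Fin 6) ℂ)} {c : ℝ} (hC : C.Nontrivial)
    (h : ∀ X ∈ C, ∀ X' ∈ C, X ≠ X' → c ≤ Complex.normSq (X - X').det) : c ≤ minDet C := by
  obtain ⟨X, hX, X', hX', hne⟩ := hC
  refine le_csInf ⟨_, X, hX, X', hX', hne, rfl⟩ ?_
  rintro d ⟨Y, hY, Y', hY', hne, rfl⟩
  rw [re_det_mul_conjTranspose]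
  exact h Y hY Y' hY' hne

section MinNorm

variable {I : Ideal (𝓞 L)}

theorem exists_natAbs_norm_eq_minNorm (hI : I ≠ ⊥) :
    ∃ x ∈ I, x ≠ 0 ∧ (Algebra.norm ℤ x).natAbs = minNorm I := by
  obtain ⟨x, hx, hx0⟩ := Submodule.exists_mem_ne_zero_of_ne_bot hI
  obtain ⟨y, hy, hy0, h⟩ :=
    Nat.sInf_mem (s := {m | ∃ x ∈ I, x ≠ 0 ∧ m = (Algebra.norm ℤ x).natAbs}) ⟨_, x, hx, hx0, rfl⟩
  exact ⟨y, hy, hy0, h.symm⟩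

theorem absNorm_le_minNorm (hI : I ≠ ⊥) : Ideal.absNorm I ≤ minNorm I := by
  obtain ⟨x, hx, hx0, h⟩ := exists_natAbs_norm_eq_minNorm hI
  exact h ▸ absNorm_le_natAbs_norm hx hx0

theorem minNorm_pos (hI : I ≠ ⊥) : 0 < minNorm I :=
  (absNorm_pos hI).trans_le (absNorm_le_minNorm hI)

theorem absNorm_lt_minNorm (hI : I ≠ ⊥) (hp : ¬ Submodule.IsPrincipal I) :
    Ideal.absNorm I < minNorm I := by
  refine (absNorm_le_minNorm hI).lt_of_ne fun h => hp ?_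
  obtain ⟨x, hx, -, hnorm⟩ := exists_natAbs_norm_eq_minNorm hI
  exact ⟨x, (eq_of_le_of_absNorm_eq ((Ideal.span_singleton_le_iff_mem I).2 hx) (absNorm_pos hI).ne'
    (by rw [Ideal.absNorm_span_singleton, hnorm, h])).symm⟩

theorem gammaI_neg (hI : I ≠ ⊥) (hp : ¬ Submodule.IsPrincipal I) : gammaI I < 0 := by
  have hN : (0 : ℝ) < Ideal.absNorm I := Nat.cast_pos.2 (absNorm_pos hI)
  have hm : (0 : ℝ) < minNorm I := Nat.cast_pos.2 (minNorm_pos hI)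
  exact mul_neg_of_pos_of_neg (by norm_num) (Real.logb_neg (by norm_num) (div_pos hN hm)
    ((div_lt_one hm).2 (Nat.cast_lt.2 (absNorm_lt_minNorm hI hp))))

end MinNorm

section Subcodes

variable {I : Ideal (𝓞 L)} {K : ℕ} {q : Fin K → Ideal (𝓞 L)} (M : LayerMap I q)
  {S : Finset (Fin K)} {v : Messages q}

theorem subcode_nonempty (S : Finset (Fin K)) (v : Messages q) : (subcode M S v).Nonempty := by
  choose x hx using fun l => Submodule.Quotient.mk_surjective _ (M fun k => v k l)
  exact ⟨_, Set.mem_biUnion (fun _ _ => rfl) ⟨x, hx, rfl⟩⟩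

variable {M}

theorem sub_codeword_mem_subcode {X : Matrix (Fin 6) (Fin 6) ℂ} (hX : X ∈ subcode M S v)
    {z : Fin 6 → 𝓞 L} (hz : ∀ l, z l ∈ I * ∏ k, q k) : X - codeword z ∈ subcode M S v := by
  lift z to Fin 6 → I using fun l => Ideal.mul_le_left (hz l)
  obtain ⟨w, hw, x, hx, rfl⟩ := Set.mem_iUnion₂.1 hX
  have hmk (l : Fin 6) : (Submodule.Quotient.mk (z l) : LayerQuotient I q) = 0 :=
    (Submodule.Quotient.mk_eq_zero _).2 (hz l)
  have hsub : codeword (fun l => (x l : 𝓞 L)) - codeword (fun l => (z l : 𝓞 L)) =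
      codeword fun l => ((x l - z l : I) : 𝓞 L) := by
    rw [← codeword_sub]
    rfl
  refine Set.mem_biUnion hw ⟨fun l => x l - z l, fun l => ?_, hsub⟩
  rw [Submodule.Quotient.mk_sub, hx, hmk, sub_zero]

theorem exists_sub_eq_codeword (hq : ∀ k ∉ S, q k ≠ ⊥) {X X' : Matrix (Fin 6) (Fin 6) ℂ}
    (hX : X ∈ subcode M S v) (hX' : X' ∈ subcode M S v) :
    ∃ z : Fin 6 → 𝓞 L, (∀ l, z l ∈ I * ∏ s ∈ S, q s) ∧ X - X' = codeword z := by
  obtain ⟨w, hw, x, hx, rfl⟩ := Set.mem_iUnion₂.1 hX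
  obtain ⟨w', hw', x', hx', rfl⟩ := Set.mem_iUnion₂.1 hX'
  refine ⟨_, fun l => ?_, (codeword_sub _ _).symm⟩
  refine mem_mul_prod_of_apply_mk_eq_zero (f := M.symm.toLinearMap) M.symm.injective hq
    (z := x l - x' l) fun s hs => ?_
  rw [Submodule.Quotient.mk_sub, hx, hx', LinearEquiv.coe_coe, map_sub, M.symm_apply_apply,
    M.symm_apply_apply, Pi.sub_apply, hw s hs, hw' s hs, sub_self]

variable (M) (S) (v)

theorem subcode_nontrivial (hI : I ≠ ⊥) (hq : ∀ k, q k ≠ ⊥) : (subcode M S v).Nontrivial := by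
  obtain ⟨z, hz, hz0⟩ := Submodule.exists_mem_ne_zero_of_ne_bot
    (mul_ne_zero hI (Finset.prod_ne_zero_iff.2 fun k _ => hq k))
  obtain ⟨X, hX⟩ := subcode_nonempty M S v
  refine ⟨X, hX, _, sub_codeword_mem_subcode hX (z := Pi.single 0 z) fun l => ?_, fun h => ?_⟩
  · rcases eq_or_ne l 0 with rfl | hl
    · rwa [Pi.single_eq_same]
    · rw [Pi.single_eq_of_ne hl]
      exact Submodule.zero_mem _
  · have hzero : codeword (Pi.single 0 z) = codeword (Pi.single 0 z - Pi.single 0 z) := by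
      rw [codeword_sub, sub_self, ← sub_eq_self.1 h.symm]
    rw [sub_self] at hzero
    exact hz0 (Pi.single_eq_zero_iff.1 (codeword_injective hzero))

theorem absNorm_le_minDet_subcode (hI : I ≠ ⊥) (hq : ∀ k, q k ≠ ⊥) :
    (Ideal.absNorm (I * ∏ s ∈ S, q s) : ℝ) ≤ minDet (subcode M S v) := by
  refine le_minDet (subcode_nontrivial M S v hI hq) fun X hX X' hX' hne => ?_
  obtain ⟨z, hz, h⟩ := exists_sub_eq_codeword (fun k _ => hq k) hX hX'
  rw [h]
  refine absNorm_le_normSq_det_codeword hz ?_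
  rintro rfl
  have hzero : codeword 0 = 0 := by simpa using codeword_sub 0 0
  exact hne (sub_eq_zero.1 (h.trans hzero))

theorem subcode_empty : subcode M ∅ v = code M := by
  simp [subcode, code]

theorem absNorm_le_minDet_code (hI : I ≠ ⊥) (hq : ∀ k, q k ≠ ⊥) :
    (Ideal.absNorm I : ℝ) ≤ minDet (code M) := by
  have h := absNorm_le_minDet_subcode M ∅ 0 hI hq
  rwa [Finset.prod_empty, mul_one, subcode_empty] at h

theorem minDet_code_pos (hI : I ≠ ⊥) (hq : ∀ k, q k ≠ ⊥) : 0 < minDet (code M) :=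
  (Nat.cast_pos.2 (absNorm_pos hI)).trans_le (absNorm_le_minDet_code M hI hq)

theorem codeword_mem_code {x : Fin 6 → 𝓞 L} (hx : ∀ l, x l ∈ I) : codeword x ∈ code M :=
  Set.mem_iUnion.2 ⟨fun k l => M.symm (Submodule.Quotient.mk ⟨x l, hx l⟩) k, fun l => ⟨x l, hx l⟩,
    fun _ => (M.apply_symm_apply _).symm, rfl⟩

theorem minDet_code_le (hI : I ≠ ⊥) : minDet (code M) ≤ minNorm I := by
  obtain ⟨a, ha, ha0, h⟩ := exists_natAbs_norm_eq_minNorm hI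
  have hsingle (l : Fin 6) : Pi.single (M := fun _ => 𝓞 L) 0 a l ∈ I := by
    rcases eq_or_ne l 0 with rfl | hl
    · rwa [Pi.single_eq_same]
    · rw [Pi.single_eq_of_ne hl]
      exact I.zero_mem
  have hne : codeword (Pi.single 0 a) ≠ codeword 0 :=
    codeword_injective.ne (Pi.single_eq_zero_iff.not.2 ha0)
  have hle := minDet_le (codeword_mem_code M hsingle)
    (codeword_mem_code M (x := 0) fun _ => I.zero_mem) hne
  rwa [← codeword_sub, sub_zero, normSq_det_codeword_single, h] at hle

end Subcodes

/-! ### The side information gain -/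

section Gain

variable {I : Ideal (𝓞 L)} {K : ℕ} {q : Fin K → Ideal (𝓞 L)}

theorem rate_eq (q : Fin K → Ideal (𝓞 L)) (k : Fin K) :
    rate q k = Real.logb 2 (Ideal.absNorm (q k)) / 12 := by
  have hcard : Nat.card (Fin 6 → 𝓞 L ⧸ q k) = Ideal.absNorm (q k) ^ 6 := by
    rw [Nat.card_fun, Nat.card_fin, Ideal.absNorm_apply, Submodule.cardQuot_apply]
  rw [rate, hcard, Nat.cast_pow, Real.logb_pow]
  push_cast
  ring

theorem sum_rate {S : Finset (Fin K)} (hq : ∀ s ∈ S, q s ≠ ⊥) :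
    ∑ s ∈ S, rate q s = Real.logb 2 (Ideal.absNorm (∏ s ∈ S, q s)) / 12 := by
  rw [map_prod, Nat.cast_prod, Real.logb_prod _ _ fun s hs => Nat.cast_ne_zero.2
    (absNorm_pos (hq s hs)).ne', Finset.sum_div]
  exact Finset.sum_congr rfl fun s _ => rate_eq q s

theorem gain_eq (M : LayerMap I q) {S : Finset (Fin K)} (hq : ∀ s ∈ S, q s ≠ ⊥) (v : Messages q) :
    gain M S v = 20 * (Real.logb 10 (minDet (subcode M S v) / minDet (code M)) /
      Real.logb 2 (Ideal.absNorm (∏ s ∈ S, q s))) := by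
  rw [gain, sum_rate hq]
  ring

theorem logb_two_add_logb_le_div {b r t x : ℝ} (hb : 1 < b) (hr0 : 0 < r) (hr1 : r ≤ 1)
    (ht : 2 ≤ t) (hx : r * t ≤ x) :
    Real.logb b 2 + Real.logb b r ≤ Real.logb b x / Real.logb 2 t := by
  have ht0 : 0 < t := two_pos.trans_le ht
  have hlog : 1 ≤ Real.logb 2 t := by
    rwa [Real.le_logb_iff_rpow_le one_lt_two ht0, Real.rpow_one]
  rw [le_div_iff₀ (one_pos.trans_le hlog)]
  calc (Real.logb b 2 + Real.logb b r) * Real.logb 2 t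
      = Real.logb b t + Real.logb b r * Real.logb 2 t := by
        rw [add_mul, Real.mul_logb two_ne_zero (by norm_num) (by norm_num)]
    _ ≤ Real.logb b t + Real.logb b r * 1 :=
        add_le_add_right
          (mul_le_mul_of_nonpos_left hlog (Real.logb_nonpos hb hr0.le hr1)) _
    _ = Real.logb b (r * t) := by rw [Real.logb_mul hr0.ne' ht0.ne', mul_one, add_comm]
    _ ≤ Real.logb b x := Real.logb_le_logb_of_le hb (mul_pos hr0 ht0) hx

theorem le_gain (hI : I ≠ ⊥) (hq : ∀ k, q k ≠ ⊥) (M : LayerMap I q) {S : Finset (Fin K)}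
    (hS : ∃ s ∈ S, q s ≠ ⊤) (v : Messages q) :
    20 * Real.logb 10 2 + gammaI I ≤ gain M S v := by
  have hN : (0 : ℝ) < Ideal.absNorm I := Nat.cast_pos.2 (absNorm_pos hI)
  have hm : (0 : ℝ) < minNorm I := Nat.cast_pos.2 (minNorm_pos hI)
  have hratio : (Ideal.absNorm I : ℝ) / minNorm I * Ideal.absNorm (∏ s ∈ S, q s) ≤
      minDet (subcode M S v) / minDet (code M) := by
    have hsub := absNorm_le_minDet_subcode M S v hI hq
    rw [map_mul, Nat.cast_mul] at hsub
    rw [div_mul_eq_mul_div]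
    exact div_le_div₀ ((by positivity : (0 : ℝ) ≤ _).trans hsub) hsub (minDet_code_pos M hI hq)
      (minDet_code_le M hI)
  rw [gain_eq M (fun s _ => hq s), gammaI, ← mul_add]
  refine mul_le_mul_of_nonneg_left (logb_two_add_logb_le_div (by norm_num) (div_pos hN hm) ?_ ?_
    hratio) (by norm_num)
  · exact (div_le_one hm).2 (Nat.cast_le.2 (absNorm_le_minNorm hI))
  · exact_mod_cast two_le_absNorm_prod (fun s _ => hq s) hS

theorem six_le_twenty_mul_logb_ten_two : 6 ≤ 20 * Real.logb 10 2 := by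
  have h : Real.logb 10 (10 ^ 3 : ℝ) ≤ Real.logb 10 (2 ^ 10 : ℝ) :=
    Real.logb_le_logb_of_le (by norm_num) (by norm_num) (by norm_num)
  rw [Real.logb_pow, Real.logb_pow, Real.logb_self_eq_one (by norm_num)] at h
  push_cast at h
  linarith

end Gain

end

end SixBySix

theorem mainTheorem6_general {I : Ideal (NumberField.RingOfIntegers SixBySix.L)} (hI : I ≠ ⊥)
    {K : ℕ} {q : Fin K → Ideal (NumberField.RingOfIntegers SixBySix.L)} (hq : ∀ k, q k ≠ ⊥)
    (M : SixBySix.LayerMap I q) {S : Finset (Fin K)} (hS : ∃ s ∈ S, q s ≠ ⊤)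
    (v : SixBySix.Messages q) :
    0 < SixBySix.minDet (SixBySix.code M) ∧
    20 * Real.logb 10 2 + SixBySix.gammaI I ≤ SixBySix.gain M S v ∧
    6 + SixBySix.gammaI I ≤ SixBySix.gain M S v ∧
    (¬ Submodule.IsPrincipal I → SixBySix.gammaI I < 0) := by
  have hgain := SixBySix.le_gain hI hq M hS v
  exact ⟨SixBySix.minDet_code_pos M hI hq, hgain,
    (add_le_add_left SixBySix.six_le_twenty_mul_logb_ten_two _).trans hgain,
    SixBySix.gammaI_neg hI⟩

theorem mainTheorem6 (I : Ideal (NumberField.RingOfIntegers SixBySix.L))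
    (h7 : Ideal.span {(7 : NumberField.RingOfIntegers SixBySix.L)} =
      I ^ 6 * SixBySix.conjIdeal I ^ 6)
    (K : ℕ) (q : Fin K → Ideal (NumberField.RingOfIntegers SixBySix.L))
    (hq0 : ∀ k, q k ≠ ⊥)
    (hqq : Pairwise fun j k => IsCoprime (q j) (q k))
    (hqI : ∀ k, IsCoprime (q k) I)
    (M : SixBySix.LayerMap I q) (S : Finset (Fin K)) (hS : ∃ s ∈ S, q s ≠ ⊤)
    (v : SixBySix.Messages q) :
    0 < SixBySix.minDet (SixBySix.code M) ∧
    20 * Real.logb 10 2 + SixBySix.gammaI I ≤ SixBySix.gain M S v ∧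
    6 + SixBySix.gammaI I ≤ SixBySix.gain M S v ∧
    (¬ Submodule.IsPrincipal I → SixBySix.gammaI I < 0) := by
  refine mainTheorem6_general ?_ hq0 M hS v
  rintro rfl
  simp at h7
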